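/- Let $n\ge 1$ be an integer, $0<d\le n$, $\alpha\in(0,d)$ and $1<p<\frac d\alpha$. For every $A,B\in[0,\infty)$ there exists a constant $C=C(\alpha,p,d,n,A,B)>0$ with the following property. Let $\mu,\nu$ be Radon measures on $\mathbb{R}^n$ such that $$\sup_{x\in\mathbb{R}^n,\ r>0}\frac{\mu(B(x,r))}{r^{d}}\le A\qquad\text{and}\qquad \sup_{\mu(Q)>0}\frac{\nu(Q)}{\mu(Q)^{1-\frac{\alpha p}{d}}}\le B,$$ where the second supremum is taken over all cubes $Q\subseteq\mathbb{R}^n$ with sides parallel to the coordinate axes and $\mu(Q)>0$ (it is $0$ if there are none). For a $\mu$-measurable real- or complex-valued function $f$ put $f^*_\mu(t)=\inf\{\lambda>0:\mu(\{|f|>\lambda\})\le t\}$ and $\|f\|_{L^{p,1}(\mathbb{R}^n,\mu)}=\int_0^{\infty}t^{\frac1p-1}f^*_\mu(t)\,dt$, and let $L^{p,1}(\mathbb{R}^n,\mu)$ consist of those $f$ for which this is finite. Then, for every $f\in L^{p,1}(\mathbb{R}^n,\mu)$, the Riesz potential $$I_\alpha^\mu f(x)=\int_{\mathbb{R}^n}\frac{f(y)}{|x-y|^{d-\alpha}}\,d\mu(y)$$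 converges absolutely for $\nu$-almost every $x\in\mathbb{R}^n$, is $\nu$-measurable, and satisfies $$\int_{\mathbb{R}^n}|I_\alpha^\mu f|^p\,d\nu\le C\,\|f\|_{L^{p,1}(\mathbb{R}^n,\mu)}^p .$$ -/

import Mathlib

open MeasureTheory
open scoped ENNReal NNReal

noncomputable section

/-- The nonincreasing rearrangement `f*_μ(t) = inf {lam > 0 : μ {|f| > lam} ≤ t}`, with values
in `[0, ∞]` (the admissible value `lam = ∞` accounts for `inf ∅ = ∞`). -/
def rearrangement {X F : Type*} [MeasurableSpace X] [NormedAddCommGroup F]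
    (μ : Measure X) (f : X → F) (t : ℝ) : ℝ≥0∞ :=
  sInf {lam : ℝ≥0∞ | 0 < lam ∧ μ {x | lam < ‖f x‖ₑ} ≤ ENNReal.ofReal t}

/-- The Lorentz norm `‖f‖_{L^{p,1}(μ)} = ∫ t^{1/p - 1} f*_μ(t) dt`. Since `f*_μ` vanishes on
`[μ(X), ∞)`, integrating over `(0, ∞)` is the same as integrating over `(0, μ(X))`. -/
def lorentzNormOne {X F : Type*} [MeasurableSpace X] [NormedAddCommGroup F]
    (p : ℝ) (μ : Measure X) (f : X → F) : ℝ≥0∞ :=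
  ∫⁻ t in Set.Ioi (0 : ℝ), ENNReal.ofReal (t ^ (1 / p - 1)) * rearrangement μ f t

/-- Membership in the Lorentz space `L^{p,1}(μ)`. -/
def MemLorentzOne {X F : Type*} [MeasurableSpace X] [NormedAddCommGroup F]
    (p : ℝ) (μ : Measure X) (f : X → F) : Prop :=
  AEStronglyMeasurable f μ ∧ lorentzNormOne p μ f < ∞

/-- The axis-parallel cube `∏ i, [a i, a i + l)` in `ℝⁿ`. -/
def cube {n : ℕ} (a : EuclideanSpace ℝ (Fin n)) (l : ℝ) : Set (EuclideanSpace ℝ (Fin n)) :=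
  {x | ∀ i, a i ≤ x i ∧ x i < a i + l}

/-- `sup_{x, r > 0} μ(B(x,r)) / r^d`. -/
def growthSup {n : ℕ} (d : ℝ) (μ : Measure (EuclideanSpace ℝ (Fin n))) : ℝ≥0∞ :=
  ⨆ (x : EuclideanSpace ℝ (Fin n)) (r : ℝ) (_ : 0 < r),
    μ (Metric.ball x r) / ENNReal.ofReal (r ^ d)

/-- `sup ν(Q) / μ(Q)^s` over all cubes `Q` with `μ(Q) > 0`. -/
def cubeRatioSup {n : ℕ} (s : ℝ) (μ ν : Measure (EuclideanSpace ℝ (Fin n))) : ℝ≥0∞ :=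
  ⨆ (a : EuclideanSpace ℝ (Fin n)) (l : ℝ) (_ : 0 < l) (_ : 0 < μ (cube a l)),
    ν (cube a l) / μ (cube a l) ^ s

/-- The integrand `y ↦ f(y) / |x - y|^{d - α}` of the Riesz potential at `x`. Its value at
`y = x` is `0` here; this is immaterial for measures without atoms, in particular for `μ` with
`growthSup d μ < ∞`, `d > 0`. -/
def rieszIntegrand {n : ℕ} {𝕜 : Type*} [RCLike 𝕜] (d α : ℝ)
    (f : EuclideanSpace ℝ (Fin n) → 𝕜) (x y : EuclideanSpace ℝ (Fin n)) : 𝕜 :=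
  (1 / ‖x - y‖ ^ (d - α)) • f y

/-- The Riesz potential `I_α^μ f(x) = ∫ f(y) / |x - y|^{d - α} dμ(y)`. -/
def rieszPotential {n : ℕ} {𝕜 : Type*} [RCLike 𝕜] (d α : ℝ)
    (μ : Measure (EuclideanSpace ℝ (Fin n))) (f : EuclideanSpace ℝ (Fin n) → 𝕜)
    (x : EuclideanSpace ℝ (Fin n)) : 𝕜 :=
  ∫ y, rieszIntegrand d α f x y ∂μ

end

/-! Let σ be μ restricted to a set of finite measure. Splitting the kernel over dyadic radii r
bounds the potential of σ by a multiple of the sum of r^α · σ(B(x,r))/r^d. Sorting the radii by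
whether the density σ(B(x,r))/r^d exceeds 2^k bounds this in turn by the sum over k of 2^k S_k(x),
where S_k(x) adds up r^α over the radii of density above 2^k. This geometric sum is comparable to
its largest term.

The heart is `lintegral_sum_dense_scales_le`. The largest dense balls are thinned to a disjoint
family by Vitali. The hypothesis on cubes gives ν(3B) ≲ r^(d-αp) as soon as σ(B) > 0, so each
selected ball contributes r^(αp) · r^(d-αp) = r^d ≤ 2^(-k) σ(B), and disjointness yields ∫ S_k^p dν
≲ 2^(-k) σ(X). The growth condition kills S_k for large k, and Minkowski leaves the sum of
2^(k(1-1/p)) over bounded k, which converges because p > 1. This is the estimate for indicators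
(`lintegral_kernel_rpow_le`).

For general f, the dyadic layers {|f| > 2^j} and Minkowski again reduce to indicators. The resulting
sum of 2^j μ{|f| > 2^j}^(1/p) is controlled by the L^{p,1} norm, which is why that norm appears. -/

/-! ### Dyadic sums in `[0, ∞]` -/

theorem two_rpow_ne_zero (a : ℝ) : (2 : ℝ≥0∞) ^ a ≠ 0 := by
  simp [ENNReal.rpow_eq_zero_iff]

theorem two_rpow_ne_top (a : ℝ) : (2 : ℝ≥0∞) ^ a ≠ ∞ := by
  simp [ENNReal.rpow_eq_top_iff]

theorem two_rpow_add (a b : ℝ) : (2 : ℝ≥0∞) ^ (a + b) = 2 ^ a * 2 ^ b :=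
  ENNReal.rpow_add _ _ (by simp) (by simp)

theorem two_rpow_lt_two_rpow {a b : ℝ} : (2 : ℝ≥0∞) ^ a < 2 ^ b ↔ a < b := by
  refine ⟨fun h => ?_, fun h => ENNReal.rpow_lt_rpow_of_exponent_lt (by simp) (by simp) h⟩
  by_contra! hab
  exact absurd h (not_lt.2 (ENNReal.rpow_le_rpow_of_exponent_le (by simp) hab))

/-- The geometric series `∑ 2 ^ (-a m)`. -/
noncomputable def dyadicGeom (a : ℝ) : ℝ≥0∞ := ∑' m : ℕ, ((2 : ℝ≥0∞) ^ (-a)) ^ m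

theorem dyadicGeom_ne_top {a : ℝ} (ha : 0 < a) : dyadicGeom a ≠ ∞ := by
  rw [dyadicGeom, ENNReal.tsum_geometric]
  refine ENNReal.inv_ne_top.2 (tsub_pos_of_lt ?_).ne'
  rw [← ENNReal.rpow_zero (x := 2), two_rpow_lt_two_rpow]
  linarith

/-- A sum of powers `2 ^ (a j)` over integers `j ≤ J` is comparable to its largest term. -/
theorem tsum_two_rpow_le {a : ℝ} {g : ℤ → ℝ≥0∞} (J : ℤ)
    (hg : ∀ j ≤ J, g j ≤ 2 ^ (a * j)) (hg0 : ∀ j, J < j → g j = 0) :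
    ∑' j, g j ≤ dyadicGeom a * 2 ^ (a * J) := by
  have hinj : Function.Injective (fun m : ℕ => J - (m : ℤ)) := fun m m' h => by
    simpa using h
  have hsupp : Function.support g ⊆ Set.range (fun m : ℕ => J - (m : ℤ)) := by
    intro j hj
    have : j ≤ J := by
      by_contra! h
      exact hj (hg0 j h)
    exact ⟨(J - j).toNat, by simp; omega⟩
  rw [← hinj.tsum_eq hsupp, dyadicGeom, ← ENNReal.tsum_mul_right]
  refine ENNReal.tsum_le_tsum fun m => (hg _ (by omega)).trans (le_of_eq ?_)
  rw [← ENNReal.rpow_natCast, ← ENNReal.rpow_mul, ← two_rpow_add]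
  push_cast
  ring_nf

theorem exists_two_rpow_lt_le {c : ℝ≥0∞} (h0 : c ≠ 0) (h1 : c ≠ ∞) :
    ∃ k : ℤ, (2 : ℝ≥0∞) ^ (k : ℝ) < c ∧ c ≤ 2 ^ ((k : ℝ) + 1) := by
  obtain ⟨k, hk⟩ := ENNReal.exists_mem_Ioc_zpow h0 h1 (y := 2) (by simp) (by simp)
  refine ⟨k, ?_, ?_⟩
  · rw [ENNReal.rpow_intCast]; exact hk.1
  · have : ((k : ℝ) + 1) = ((k + 1 : ℤ) : ℝ) := by push_cast; rfl
    rw [this, ENNReal.rpow_intCast]; exact hk.2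

theorem le_tsum_dyadic {c : ℝ≥0∞} (h1 : c ≠ ∞) :
    c ≤ 2 * ∑' k : ℤ, if (2 : ℝ≥0∞) ^ (k : ℝ) < c then (2 : ℝ≥0∞) ^ (k : ℝ) else 0 := by
  rcases eq_or_ne c 0 with rfl | h0
  · simp
  obtain ⟨k, hk, hk'⟩ := exists_two_rpow_lt_le h0 h1
  rw [two_rpow_add, ENNReal.rpow_one, mul_comm] at hk'
  refine hk'.trans ?_
  gcongr
  refine le_trans (le_of_eq ?_) (ENNReal.le_tsum k)
  rw [if_pos hk]

/-- The powers `2 ^ (a k)` with `2 ^ k ≤ c` have a sum comparable to `c ^ a`. -/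
theorem tsum_dyadic_le {a : ℝ} (ha : 0 < a) (c : ℝ≥0∞) {g : ℤ → ℝ≥0∞}
    (hg : ∀ j : ℤ, g j ≤ 2 ^ (a * j)) (hg0 : ∀ j : ℤ, c < 2 ^ (j : ℝ) → g j = 0) :
    ∑' j, g j ≤ dyadicGeom a * c ^ a := by
  rcases eq_or_ne c 0 with rfl | h0
  · have : ∀ j, g j = 0 := fun j => hg0 j (pos_iff_ne_zero.2 (two_rpow_ne_zero _))
    simp [this]
  rcases eq_or_ne c ∞ with rfl | h1
  -- The right side is infinite, since the term m = 0 already makes `dyadicGeom a` at least 1.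
  · rw [ENNReal.top_rpow_of_pos ha, ENNReal.mul_top]
    · exact le_top
    · refine (lt_of_lt_of_le ?_ (ENNReal.le_tsum 0)).ne'
      simp
  obtain ⟨k, hk, hk'⟩ := ENNReal.exists_mem_Ico_zpow h0 h1 (y := 2) (by simp) (by simp)
  rw [← ENNReal.rpow_intCast] at hk hk'
  refine (tsum_two_rpow_le (a := a) k (fun j _ => hg j) (fun j hj => hg0 j ?_)).trans ?_
  · refine hk'.trans_le (ENNReal.rpow_le_rpow_of_exponent_le (by simp) ?_)
    exact_mod_cast hj
  · gcongr
    rw [mul_comm, ENNReal.rpow_mul]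
    exact ENNReal.rpow_le_rpow hk ha.le

/-! ### Minkowski's inequality and the discrete Lorentz norm -/

/-- Minkowski's inequality for countable sums. -/
theorem lintegral_Lp_tsum_le {X ι : Type*} [Countable ι] [MeasurableSpace X] {ν : Measure X}
    {p : ℝ} (hp : 1 ≤ p) {f : ι → X → ℝ≥0∞} (hf : ∀ i, Measurable (f i)) :
    (∫⁻ x, (∑' i, f i x) ^ p ∂ν) ^ (1 / p) ≤ ∑' i, (∫⁻ x, f i x ^ p ∂ν) ^ (1 / p) := by
  have hp0 : 0 < p := by linarith
  have fin : ∀ s : Finset ι, (∫⁻ x, (∑ i ∈ s, f i x) ^ p ∂ν) ^ (1 / p) ≤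
      ∑ i ∈ s, (∫⁻ x, f i x ^ p ∂ν) ^ (1 / p) := by
    classical
    intro s
    induction s using Finset.induction_on with
    | empty => simp [hp0]
    | insert i s his ih =>
      simp only [Finset.sum_insert his]
      refine (ENNReal.lintegral_Lp_add_le (hf i).aemeasurable
        (Finset.measurable_fun_sum s fun i _ => hf i).aemeasurable hp).trans ?_
      gcongr
  have key : ∀ x, (∑' i, f i x) ^ p = ⨆ s : Finset ι, (∑ i ∈ s, f i x) ^ p := fun x => by
    rw [ENNReal.tsum_eq_iSup_sum]
    exact (ENNReal.orderIsoRpow p hp0).map_iSup _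
  simp_rw [key]
  rw [lintegral_iSup_directed_of_measurable
    (fun s => (Finset.measurable_fun_sum s fun i _ => hf i).pow_const p)
    (Monotone.directed_le fun s t hst x =>
      ENNReal.rpow_le_rpow (Finset.sum_le_sum_of_subset hst) hp0.le)]
  rw [show ∀ c : ℝ≥0∞, c ^ (1 / p) = ENNReal.orderIsoRpow (1 / p) (by positivity) c from
    fun _ => rfl, OrderIso.map_iSup]
  exact iSup_le fun s => (fin s).trans (ENNReal.sum_le_tsum s)

/-- The discrete form of the layer cake formula for the Lorentz norm. -/
theorem tsum_measure_rpow_le_lorentzNormOne {X F : Type*} [MeasurableSpace X]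
    [NormedAddCommGroup F] {p : ℝ} (hp : 1 < p) (μ : Measure X) (f : X → F) :
    ∑' j : ℤ, (2 : ℝ≥0∞) ^ (j : ℝ) * μ {x | (2 : ℝ≥0∞) ^ (j : ℝ) < ‖f x‖ₑ} ^ (1 / p) ≤
      dyadicGeom 1 * lorentzNormOne p μ f := by
  have hp0 : 0 < p := by linarith
  set m : ℤ → ℝ≥0∞ := fun j => μ {x | (2 : ℝ≥0∞) ^ (j : ℝ) < ‖f x‖ₑ} with hm
  -- the power function integrates to at least `c ^ (1 / p)` over `(0, c)`
  have hpow : ∀ c : ℝ≥0∞, c ^ (1 / p) ≤ ∫⁻ t in Set.Ioi (0 : ℝ),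
      ENNReal.ofReal (t ^ (1 / p - 1)) * (if ENNReal.ofReal t < c then 1 else 0) := by
    intro c
    refine ENNReal.le_of_forall_nnreal_lt fun r hr => ?_
    rcases eq_or_ne r 0 with rfl | hr0
    · simp
    have hr0' : (0 : ℝ) < r := by positivity
    have hs : (0 : ℝ) < (r : ℝ) ^ p := by positivity
    have hsc : ENNReal.ofReal ((r : ℝ) ^ p) < c := by
      rw [← ENNReal.ofReal_rpow_of_pos hr0', ENNReal.ofReal_coe_nnreal]
      rwa [one_div, ENNReal.lt_rpow_inv_iff hp0] at hr
    -- The power is nonincreasing because p > 1, so on (0, r^p) it is at least its value at the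
    -- right endpoint. This loses only a factor p and also covers c = ∞.
    calc (r : ℝ≥0∞) = ∫⁻ t in Set.Ioo (0 : ℝ) ((r : ℝ) ^ p),
          ENNReal.ofReal (((r : ℝ) ^ p) ^ (1 / p - 1)) := by
          rw [setLIntegral_const, Real.volume_Ioo, sub_zero, ← ENNReal.ofReal_mul (by positivity),
            Real.rpow_sub_one hs.ne', div_mul_cancel₀ _ hs.ne', ← Real.rpow_mul hr0'.le,
            mul_one_div_cancel hp0.ne', Real.rpow_one, ENNReal.ofReal_coe_nnreal]
      _ ≤ ∫⁻ t in Set.Ioo (0 : ℝ) ((r : ℝ) ^ p),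
          ENNReal.ofReal (t ^ (1 / p - 1)) * (if ENNReal.ofReal t < c then 1 else 0) := by
          refine setLIntegral_mono' measurableSet_Ioo fun t ht => ?_
          rw [if_pos ((ENNReal.ofReal_le_ofReal ht.2.le).trans_lt hsc), mul_one]
          refine ENNReal.ofReal_le_ofReal (Real.rpow_le_rpow_of_nonpos ht.1 ht.2.le ?_)
          rw [sub_nonpos, div_le_one hp0]
          exact hp.le
      _ ≤ _ := lintegral_mono_set Set.Ioo_subset_Ioi_self
  have hstar : ∀ t : ℝ, ∑' j : ℤ, (2 : ℝ≥0∞) ^ (j : ℝ) *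
      (if ENNReal.ofReal t < m j then 1 else 0) ≤ dyadicGeom 1 * rearrangement μ f t := by
    intro t
    nth_rw 1 [← ENNReal.rpow_one (rearrangement μ f t)]
    refine tsum_dyadic_le one_pos _ (fun j => ?_) (fun j hj => ?_)
    · rw [one_mul]
      split_ifs <;> simp
    · rw [if_neg, mul_zero]
      -- If 2^j exceeds f*(t), some admissible level lies below 2^j, so level j has measure at most
      -- t and its term vanishes.
      obtain ⟨lam, ⟨-, hlam⟩, hlj⟩ := sInf_lt_iff.1 hj
      exact not_lt.2 ((measure_mono fun x hx => hlj.trans hx).trans hlam)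
  calc ∑' j : ℤ, (2 : ℝ≥0∞) ^ (j : ℝ) * m j ^ (1 / p)
      ≤ ∑' j : ℤ, (2 : ℝ≥0∞) ^ (j : ℝ) * ∫⁻ t in Set.Ioi (0 : ℝ),
        ENNReal.ofReal (t ^ (1 / p - 1)) * (if ENNReal.ofReal t < m j then 1 else 0) := by
        gcongr with j
        exact hpow _
    _ = ∫⁻ t in Set.Ioi (0 : ℝ), ∑' j : ℤ, (2 : ℝ≥0∞) ^ (j : ℝ) *
        (ENNReal.ofReal (t ^ (1 / p - 1)) * (if ENNReal.ofReal t < m j then 1 else 0)) := by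
        have hmeas : ∀ j, Measurable fun t : ℝ =>
            ENNReal.ofReal (t ^ (1 / p - 1)) * (if ENNReal.ofReal t < m j then 1 else 0) := by
          intro j
          refine Measurable.mul (by fun_prop) (Measurable.ite ?_ measurable_const measurable_const)
          exact measurableSet_lt ENNReal.measurable_ofReal measurable_const
        rw [lintegral_tsum fun j => ((hmeas j).const_mul _).aemeasurable]
        refine tsum_congr fun j => (lintegral_const_mul _ (hmeas j)).symm
    _ ≤ ∫⁻ t in Set.Ioi (0 : ℝ),
        dyadicGeom 1 * (ENNReal.ofReal (t ^ (1 / p - 1)) * rearrangement μ f t) := by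
        refine lintegral_mono fun t => ?_
        simp_rw [mul_left_comm _ (ENNReal.ofReal (t ^ (1 / p - 1)))]
        rw [ENNReal.tsum_mul_left]
        gcongr
        exact hstar t
    _ = dyadicGeom 1 * lorentzNormOne p μ f := by
        rw [lintegral_const_mul' _ _ (dyadicGeom_ne_top one_pos)]
        rfl

/-! ### Potentials of finite measures -/

theorem exists_le_two_rpow_mul {d : ℝ} (hd : 0 < d) {M : ℝ≥0∞} (hM : M ≠ ∞) :
    ∃ J : ℤ, M ≤ 2 ^ (d * J) := by
  obtain ⟨k, hk⟩ := ENNReal.exists_nat_gt hM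
  refine ⟨⌈(k : ℝ) / d⌉, hk.le.trans ?_⟩
  have h1 : (k : ℝ≥0∞) ≤ 2 ^ (k : ℝ) := by
    rw [ENNReal.rpow_natCast]
    exact_mod_cast Nat.lt_two_pow_self.le
  refine h1.trans (ENNReal.rpow_le_rpow_of_exponent_le (by simp) ?_)
  rw [mul_comm, ← div_le_iff₀ hd]
  exact Int.le_ceil _

/-- Let `r(x)` be the largest dyadic radius at which the density `σ(B(x, r)) / r ^ d` exceeds `t`.
The `L^p(ν)` norm of the sum of `r ^ α` over all such radii is controlled, via a Vitali covering,
by the total mass of `σ`. -/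
theorem lintegral_sum_dense_scales_le {X : Type*} [MetricSpace X] [SecondCountableTopology X]
    [MeasurableSpace X] [OpensMeasurableSpace X] (σ ν : Measure X) [IsFiniteMeasure σ]
    {p α d : ℝ} (hp : 0 < p) (hα : 0 < α) (hd : 0 < d) {K : ℝ≥0∞}
    (hν : ∀ (x : X) (i : ℤ), 0 < σ (Metric.closedBall x ((2 : ℝ) ^ i)) →
      ν (Metric.closedBall x (3 * (2 : ℝ) ^ i)) ≤ K * 2 ^ ((d - α * p) * i))
    {t : ℝ≥0∞} (ht0 : t ≠ 0) (ht : t ≠ ∞) :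
    ∫⁻ x, (∑' i : ℤ, if t * 2 ^ (d * i) < σ (Metric.closedBall x ((2 : ℝ) ^ i))
        then (2 : ℝ≥0∞) ^ (α * i) else 0) ^ p ∂ν ≤
      dyadicGeom α ^ p * 2 ^ (α * p) * K * (t⁻¹ * σ Set.univ) := by
  classical
  obtain ⟨J, hJ⟩ := exists_le_two_rpow_mul hd (M := t⁻¹ * σ Set.univ)
    (ENNReal.mul_ne_top (ENNReal.inv_ne_top.2 ht0) (measure_ne_top _ _))
  set G : ℤ → Set X := fun i => {x | t * 2 ^ (d * i) < σ (Metric.closedBall x ((2 : ℝ) ^ i))}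
    with hG
  -- Finite total mass bounds the dense radii uniformly in x, so a largest one exists and Vitali
  -- applies.
  have hGJ : ∀ i x, x ∈ G i → i ≤ J := by
    intro i x hx
    by_contra! hi
    have h1 : t * 2 ^ (d * i) < t * 2 ^ (d * J) := by
      refine (lt_of_lt_of_le hx (measure_mono (Set.subset_univ _))).trans_le ?_
      rwa [← ENNReal.inv_mul_le_iff ht0 ht]
    rw [ENNReal.mul_lt_mul_iff_right ht0 ht, two_rpow_lt_two_rpow, mul_lt_mul_iff_right₀ hd] at h1
    exact absurd h1 (by exact_mod_cast hi.le.not_gt)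
  set T : Set X := {x | ∃ i, x ∈ G i} with hT
  have hI : ∀ x, ∃ I : ℤ, x ∈ T → x ∈ G I ∧ ∀ j, x ∈ G j → j ≤ I := by
    intro x
    by_cases hx : x ∈ T
    · obtain ⟨I, h1, h2⟩ := Int.exists_greatest_of_bdd (P := fun i => x ∈ G i)
        ⟨J, fun i hi => hGJ i x hi⟩ hx
      exact ⟨I, fun _ => ⟨h1, h2⟩⟩
    · exact ⟨0, fun h => absurd h hx⟩
  choose I hI using hI
  obtain ⟨u, huT, hdisj, hcov⟩ := Vitali.exists_disjoint_subfamily_covering_enlargement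
    (fun x => Metric.closedBall x ((2 : ℝ) ^ I x)) T (fun x => (2 : ℝ) ^ I x) 2 one_lt_two
    (fun x _ => by positivity) ((2 : ℝ) ^ J)
    (fun x hx => zpow_le_zpow_right₀ one_le_two (hGJ _ x (hI x hx).1))
    (fun x _ => ⟨x, Metric.mem_closedBall_self (by positivity)⟩)
  have hu : u.Countable := by
    refine hdisj.countable_of_nonempty_interior fun x _ => ⟨x, ?_⟩
    exact Metric.ball_subset_interior_closedBall (Metric.mem_ball_self (by positivity))
  have := hu.to_subtype
  -- The shift by 1 absorbs the factor 2 that Vitali allows between the radius at x and that of the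
  -- selected ball.
  set W : X → ℝ≥0∞ := fun b => dyadicGeom α ^ p * 2 ^ (α * p * (I b + 1)) with hW
  have hpt : ∀ x, (∑' i : ℤ, if x ∈ G i then (2 : ℝ≥0∞) ^ (α * i) else 0) ^ p ≤
      ∑' b : u, (Metric.closedBall (b : X) (3 * (2 : ℝ) ^ I b)).indicator (fun _ => W b) x := by
    intro x
    by_cases hx : x ∈ T
    · obtain ⟨b, hb, ⟨z, hzx, hzb⟩, hle⟩ := hcov x hx
      have hIle : I x ≤ I b + 1 := by
        have : (2 : ℝ) ^ I x ≤ 2 ^ (I b + 1) := by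
          rw [zpow_add_one₀ two_ne_zero, mul_comm]; exact hle
        exact (zpow_le_zpow_iff_right₀ one_lt_two).1 this
      refine le_trans ?_ (ENNReal.le_tsum ⟨b, hb⟩)
      rw [Set.indicator_of_mem]
      · calc _ ≤ (dyadicGeom α * 2 ^ (α * I x)) ^ p := by
              gcongr
              refine tsum_two_rpow_le (I x) (fun j _ => ?_) (fun j hj => ?_)
              · split_ifs <;> simp
              · rw [if_neg]
                exact fun h => absurd ((hI x hx).2 j h) (not_le.2 hj)
          _ = dyadicGeom α ^ p * 2 ^ (α * p * I x) := by
              rw [ENNReal.mul_rpow_of_nonneg _ _ hp.le, ← ENNReal.rpow_mul]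
              ring_nf
          _ ≤ W b := by
              simp only [hW]
              gcongr
              · simp
              · exact_mod_cast hIle
      -- Only the centre x has to be covered: the balls meet and r_x ≤ 2 r_b, so dist(x, b) ≤ r_x +
      -- r_b ≤ 3 r_b.
      · rw [Metric.mem_closedBall] at hzx hzb ⊢
        have := dist_triangle_left x b z
        linarith
    · have : ∀ i, x ∉ G i := fun i hi => hx ⟨i, hi⟩
      simp [this, hp]
  calc _ ≤ ∫⁻ x, ∑' b : u,
          (Metric.closedBall (b : X) (3 * (2 : ℝ) ^ I b)).indicator (fun _ => W b) x ∂ν :=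
        lintegral_mono hpt
    _ = ∑' b : u, W b * ν (Metric.closedBall (b : X) (3 * (2 : ℝ) ^ I b)) := by
        rw [lintegral_tsum fun b =>
          (measurable_const.indicator Metric.isClosed_closedBall.measurableSet).aemeasurable]
        exact tsum_congr fun b =>
          lintegral_indicator_const Metric.isClosed_closedBall.measurableSet _
    _ ≤ ∑' b : u, dyadicGeom α ^ p * 2 ^ (α * p) * K *
          (t⁻¹ * σ (Metric.closedBall (b : X) ((2 : ℝ) ^ I b))) := by
        refine ENNReal.tsum_le_tsum fun b => ?_
        have hb := (hI b (huT b.2)).1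
        calc _ ≤ W b * (K * 2 ^ ((d - α * p) * I b)) := by
              refine mul_le_mul_right ?_ _
              exact hν b _ (lt_of_le_of_lt zero_le hb)
          _ = dyadicGeom α ^ p * 2 ^ (α * p) * K * 2 ^ (d * I b) := by
              have : (2 : ℝ≥0∞) ^ (α * p * (I b + 1)) * 2 ^ ((d - α * p) * I b) =
                  2 ^ (α * p) * 2 ^ (d * I b) := by
                rw [← two_rpow_add, ← two_rpow_add]
                ring_nf
              simp only [hW]
              rw [mul_mul_mul_comm, this]
              ring
          _ ≤ _ := by
              refine mul_le_mul_right ?_ _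
              rw [mul_comm t⁻¹, ← div_eq_mul_inv, ENNReal.le_div_iff_mul_le (Or.inl ht0) (Or.inl ht),
                mul_comm]
              exact hb.le
    _ ≤ _ := by
        rw [ENNReal.tsum_mul_left, ENNReal.tsum_mul_left]
        gcongr
        rw [← measure_biUnion hu hdisj fun b _ => Metric.isClosed_closedBall.measurableSet]
        exact measure_mono (Set.subset_univ _)

theorem measurable_measure_closedBall {X : Type*} [MetricSpace X] [SecondCountableTopology X]
    [MeasurableSpace X] [OpensMeasurableSpace X] (σ : Measure X) [SFinite σ] (r : ℝ) :
    Measurable fun x => σ (Metric.closedBall x r) := by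
  have h : MeasurableSet {q : X × X | dist q.2 q.1 ≤ r} :=
    measurableSet_le (by fun_prop) measurable_const
  exact measurable_measure_prodMk_left h

theorem ofReal_two_zpow (i : ℤ) : ENNReal.ofReal ((2 : ℝ) ^ i) = (2 : ℝ≥0∞) ^ (i : ℝ) := by
  rw [← Real.rpow_intCast, ← ENNReal.ofReal_rpow_of_pos two_pos]
  simp

/-- Dyadic decomposition of the kernel `|x - y| ^ (-β)`. -/
theorem lintegral_kernel_le_tsum {X : Type*} [MetricSpace X] [MeasurableSpace X]
    [OpensMeasurableSpace X] (σ : Measure X) {β : ℝ} (hβ : 0 < β) (x : X) :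
    ∫⁻ y, ENNReal.ofReal (1 / dist x y ^ β) ∂σ ≤
      ∑' i : ℤ, 2 ^ (β * (1 - i)) * σ (Metric.closedBall x ((2 : ℝ) ^ i)) := by
  have hk : ∀ y, ENNReal.ofReal (1 / dist x y ^ β) ≤ ∑' i : ℤ,
      (Metric.closedBall x ((2 : ℝ) ^ i)).indicator (fun _ => (2 : ℝ≥0∞) ^ (β * (1 - i))) y := by
    intro y
    rcases eq_or_ne x y with rfl | hxy
    -- On the diagonal the kernel is 1 / 0 = 0 by convention.
    · simp [Real.zero_rpow hβ.ne']
    have hpos := dist_pos.2 hxy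
    obtain ⟨k, hk1, hk2⟩ := exists_mem_Ioc_zpow hpos one_lt_two
    -- With 2^k < dist x y ≤ 2^(k+1), the ball of index k + 1 contains y, and its weight
    -- 2^(β(1-(k+1))) = 2^(-βk) bounds the kernel.
    refine le_trans ?_ (ENNReal.le_tsum (k + 1))
    rw [Set.indicator_of_mem (by rwa [Metric.mem_closedBall, dist_comm])]
    rw [one_div, ENNReal.ofReal_inv_of_pos (by positivity), ← ENNReal.ofReal_rpow_of_pos hpos]
    have : β * (1 - ((k + 1 : ℤ) : ℝ)) = -(k * β) := by push_cast; ring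
    rw [this, ENNReal.rpow_neg, ENNReal.inv_le_inv, ENNReal.rpow_mul]
    refine ENNReal.rpow_le_rpow ?_ hβ.le
    rw [← ofReal_two_zpow]
    exact ENNReal.ofReal_le_ofReal hk1.le
  refine (lintegral_mono hk).trans (le_of_eq ?_)
  rw [lintegral_tsum fun b =>
    (measurable_const.indicator Metric.isClosed_closedBall.measurableSet).aemeasurable]
  exact tsum_congr fun b => lintegral_indicator_const Metric.isClosed_closedBall.measurableSet _

/-- The restricted strong type estimate: the potential of a finite measure `σ` of growth `d`. -/
theorem lintegral_kernel_rpow_le {X : Type*} [MetricSpace X] [SecondCountableTopology X]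
    [MeasurableSpace X] [OpensMeasurableSpace X] (σ ν : Measure X) [IsFiniteMeasure σ]
    {p α d : ℝ} (hp : 1 < p) (hα : 0 < α) (hαd : α < d) {K A : ℝ≥0∞}
    (hν : ∀ (x : X) (i : ℤ), 0 < σ (Metric.closedBall x ((2 : ℝ) ^ i)) →
      ν (Metric.closedBall x (3 * (2 : ℝ) ^ i)) ≤ K * 2 ^ ((d - α * p) * i))
    (hσ : ∀ (x : X) (i : ℤ), σ (Metric.closedBall x ((2 : ℝ) ^ i)) ≤ A * 2 ^ (d * i)) :
    (∫⁻ x, (∫⁻ y, ENNReal.ofReal (1 / dist x y ^ (d - α)) ∂σ) ^ p ∂ν) ^ (1 / p) ≤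
      2 * 2 ^ (d - α) * (dyadicGeom α ^ p * 2 ^ (α * p) * K) ^ (1 / p) *
        (dyadicGeom (1 - 1 / p) * A ^ (1 - 1 / p)) * σ Set.univ ^ (1 / p) := by
  have hp0 : 0 < p := by linarith
  have hd : 0 < d := by linarith
  have hp1 : 0 < 1 - 1 / p := by
    rw [sub_pos, div_lt_one hp0]; exact hp
  set S : ℤ → X → ℝ≥0∞ := fun k x =>
    ∑' i : ℤ, if (2 : ℝ≥0∞) ^ (k : ℝ) * 2 ^ (d * i) < σ (Metric.closedBall x ((2 : ℝ) ^ i))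
        then (2 : ℝ≥0∞) ^ (α * i) else 0 with hS
  set M : ℝ≥0∞ := dyadicGeom α ^ p * 2 ^ (α * p) * K
  have hSmeas : ∀ k, Measurable (S k) := fun k => Measurable.tsum fun i =>
    Measurable.ite (measurableSet_lt measurable_const (measurable_measure_closedBall σ _))
      measurable_const measurable_const
  have hSint : ∀ k, ∫⁻ x, S k x ^ p ∂ν ≤ M * (((2 : ℝ≥0∞) ^ (k : ℝ))⁻¹ * σ Set.univ) := fun k =>
    lintegral_sum_dense_scales_le σ ν hp0 hα hd hν (two_rpow_ne_zero _) (two_rpow_ne_top _)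
  clear_value M
  -- By the growth bound no density exceeds A.
  have hSzero : ∀ k : ℤ, A < (2 : ℝ≥0∞) ^ (k : ℝ) → ∀ x, S k x = 0 := by
    intro k hk x
    refine ENNReal.tsum_eq_zero.2 fun i => if_neg (not_lt.2 ((hσ x i).trans ?_))
    gcongr
  have hpt : ∀ x, ∫⁻ y, ENNReal.ofReal (1 / dist x y ^ (d - α)) ∂σ ≤
      ∑' k : ℤ, 2 * 2 ^ (d - α) * 2 ^ (k : ℝ) * S k x := by
    intro x
    refine (lintegral_kernel_le_tsum σ (sub_pos.2 hαd) x).trans ?_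
    simp_rw [hS, ← ENNReal.tsum_mul_left]
    rw [ENNReal.tsum_comm]
    refine ENNReal.tsum_le_tsum fun i => ?_
    set m := σ (Metric.closedBall x ((2 : ℝ) ^ i))
    have h0 := two_rpow_ne_zero (d * i)
    have h1 := two_rpow_ne_top (d * i)
    have hc := le_tsum_dyadic (c := m / 2 ^ (d * i)) (ENNReal.div_ne_top (measure_ne_top _ _) h0)
    calc (2 : ℝ≥0∞) ^ ((d - α) * (1 - i)) * m
        = 2 ^ (d - α) * 2 ^ (α * i) * (m / 2 ^ (d * i)) := by
          have : (d - α) * (1 - i) = (d - α) + α * i + -(d * i) := by ring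
          rw [this, two_rpow_add, two_rpow_add, ENNReal.rpow_neg, div_eq_mul_inv]
          ring
      _ ≤ _ := mul_le_mul_right hc _
      _ = _ := by
          rw [← ENNReal.tsum_mul_left, ← ENNReal.tsum_mul_left]
          refine tsum_congr fun k => ?_
          simp only [ENNReal.lt_div_iff_mul_lt (Or.inl h0) (Or.inl h1)]
          split_ifs
          · ring
          · simp
  calc _ ≤ (∫⁻ x, (∑' k : ℤ, 2 * 2 ^ (d - α) * 2 ^ (k : ℝ) * S k x) ^ p ∂ν) ^ (1 / p) := by
        gcongr with x
        exact hpt x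
    _ ≤ ∑' k : ℤ, (∫⁻ x, (2 * 2 ^ (d - α) * 2 ^ (k : ℝ) * S k x) ^ p ∂ν) ^ (1 / p) :=
        lintegral_Lp_tsum_le hp.le fun k => (hSmeas k).const_mul _
    _ = ∑' k : ℤ, 2 * 2 ^ (d - α) * (2 ^ (k : ℝ) * (∫⁻ x, S k x ^ p ∂ν) ^ (1 / p)) := by
        refine tsum_congr fun k => ?_
        simp_rw [ENNReal.mul_rpow_of_nonneg _ (S k _) hp0.le]
        rw [lintegral_const_mul _ ((hSmeas k).pow_const p),
          ENNReal.mul_rpow_of_nonneg _ _ (by positivity), ← ENNReal.rpow_mul,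
          mul_one_div_cancel hp0.ne', ENNReal.rpow_one, mul_assoc]
    _ ≤ ∑' k : ℤ, 2 * 2 ^ (d - α) * (M ^ (1 / p) * σ Set.univ ^ (1 / p) *
          (if A < (2 : ℝ≥0∞) ^ (k : ℝ) then 0 else 2 ^ ((1 - 1 / p) * k))) := by
        refine ENNReal.tsum_le_tsum fun k => mul_le_mul_right ?_ _
        split_ifs with hk
        · simp [hSzero k hk, hp0]
        · calc _ ≤ (2 : ℝ≥0∞) ^ (k : ℝ) *
                (M * (((2 : ℝ≥0∞) ^ (k : ℝ))⁻¹ * σ Set.univ)) ^ (1 / p) := by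
                gcongr
                exact hSint k
            _ = _ := by
                have : (1 - 1 / p) * (k : ℝ) = k + (-(k : ℝ)) * (1 / p) := by ring
                rw [ENNReal.mul_rpow_of_nonneg _ _ (by positivity),
                  ENNReal.mul_rpow_of_nonneg _ _ (by positivity), ← ENNReal.rpow_neg,
                  ← ENNReal.rpow_mul, this, two_rpow_add]
                ring
    _ ≤ 2 * 2 ^ (d - α) * (M ^ (1 / p) * σ Set.univ ^ (1 / p) *
          (dyadicGeom (1 - 1 / p) * A ^ (1 - 1 / p))) := by
        rw [ENNReal.tsum_mul_left, ENNReal.tsum_mul_left]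
        gcongr
        refine tsum_dyadic_le hp1 A (fun k => ?_) (fun k hk => if_pos hk)
        split_ifs <;> simp
    _ = _ := by ring

/-! ### From indicators to Lorentz functions -/

/-- Since |f| is at most twice the sum of 2^j over the levels 2^j < |f|, its potential is dominated
by those of the level sets. Minkowski costs nothing because the target norm is itself a sum over
levels. -/
theorem lintegral_kernel_mul_enorm_rpow_le {X F : Type*} [MetricSpace X]
    [SecondCountableTopology X] [MeasurableSpace X] [OpensMeasurableSpace X]
    [NormedAddCommGroup F] (μ ν : Measure X) [SFinite μ] {p β : ℝ} (hp : 1 < p) {C : ℝ≥0∞}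
    (hE : ∀ E : Set X, μ E < ∞ →
      (∫⁻ x, (∫⁻ y in E, ENNReal.ofReal (1 / dist x y ^ β) ∂μ) ^ p ∂ν) ^ (1 / p) ≤
        C * μ E ^ (1 / p))
    {f : X → F} (hf : AEStronglyMeasurable f μ) (hfin : lorentzNormOne p μ f < ∞) :
    (∫⁻ x, (∫⁻ y, ENNReal.ofReal (1 / dist x y ^ β) * ‖f y‖ₑ ∂μ) ^ p ∂ν) ^ (1 / p) ≤
      2 * C * dyadicGeom 1 * lorentzNormOne p μ f := by
  have hp0 : 0 < p := by linarith
  set E : ℤ → Set X := fun j => {x | (2 : ℝ≥0∞) ^ (j : ℝ) < ‖f x‖ₑ}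
  have hEmeas : ∀ j, NullMeasurableSet (E j) μ := fun j =>
    nullMeasurableSet_lt aemeasurable_const hf.enorm
  have hsum := tsum_measure_rpow_le_lorentzNormOne hp μ f
  have hEfin : ∀ j, μ (E j) < ∞ := by
    intro j
    have h1 : (2 : ℝ≥0∞) ^ (j : ℝ) * μ (E j) ^ (1 / p) < ∞ :=
      ((ENNReal.le_tsum j).trans hsum).trans_lt
        (ENNReal.mul_lt_top (dyadicGeom_ne_top one_pos).lt_top hfin)
    by_contra! h
    rw [top_le_iff.1 h, ENNReal.top_rpow_of_pos (by positivity),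
      ENNReal.mul_top (two_rpow_ne_zero _)] at h1
    exact lt_irrefl _ h1
  have hker : Measurable fun q : X × X => ENNReal.ofReal (1 / dist q.1 q.2 ^ β) :=
    ((measurable_dist.pow_const β).const_div 1).ennreal_ofReal
  have hkerx : ∀ x : X, Measurable fun y : X => ENNReal.ofReal (1 / dist x y ^ β) := fun x =>
    hker.comp measurable_prodMk_left
  set P : ℤ → X → ℝ≥0∞ := fun j x => ∫⁻ y in E j, ENNReal.ofReal (1 / dist x y ^ β) ∂μ
  have hPmeas : ∀ j, Measurable (P j) := fun j => hker.lintegral_prod_right'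
  have hpt : ∀ x, ∫⁻ y, ENNReal.ofReal (1 / dist x y ^ β) * ‖f y‖ₑ ∂μ ≤
      ∑' j : ℤ, 2 * 2 ^ (j : ℝ) * P j x := by
    intro x
    calc _ ≤ ∫⁻ y, ∑' j : ℤ, 2 * 2 ^ (j : ℝ) *
            (E j).indicator (fun y => ENNReal.ofReal (1 / dist x y ^ β)) y ∂μ := by
          refine lintegral_mono fun y => ?_
          refine (mul_le_mul_right (le_tsum_dyadic enorm_ne_top) _).trans (le_of_eq ?_)
          rw [← ENNReal.tsum_mul_left, ← ENNReal.tsum_mul_left]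
          refine tsum_congr fun j => ?_
          by_cases h : (2 : ℝ≥0∞) ^ (j : ℝ) < ‖f y‖ₑ
          · rw [if_pos h, Set.indicator_of_mem (show y ∈ E j from h)]
            ring
          · rw [if_neg h, Set.indicator_of_notMem (show y ∉ E j from h)]
            simp
      _ = _ := by
          have hm : ∀ j, AEMeasurable
              ((E j).indicator fun y => ENNReal.ofReal (1 / dist x y ^ β)) μ := fun j =>
            (hkerx x).aemeasurable.indicator₀ (hEmeas j)
          rw [lintegral_tsum fun j => (hm j).const_mul _]
          refine tsum_congr fun j => ?_
          rw [lintegral_const_mul'' _ (hm j), lintegral_indicator₀ (hEmeas j)]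
  calc _ ≤ (∫⁻ x, (∑' j : ℤ, 2 * 2 ^ (j : ℝ) * P j x) ^ p ∂ν) ^ (1 / p) := by
        gcongr with x
        exact hpt x
    _ ≤ ∑' j : ℤ, (∫⁻ x, (2 * 2 ^ (j : ℝ) * P j x) ^ p ∂ν) ^ (1 / p) :=
        lintegral_Lp_tsum_le hp.le fun j => (hPmeas j).const_mul _
    _ = ∑' j : ℤ, 2 * 2 ^ (j : ℝ) * (∫⁻ x, P j x ^ p ∂ν) ^ (1 / p) := by
        refine tsum_congr fun j => ?_
        simp_rw [ENNReal.mul_rpow_of_nonneg _ (P j _) hp0.le]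
        rw [lintegral_const_mul _ ((hPmeas j).pow_const p),
          ENNReal.mul_rpow_of_nonneg _ _ (by positivity), ← ENNReal.rpow_mul,
          mul_one_div_cancel hp0.ne', ENNReal.rpow_one]
    _ ≤ ∑' j : ℤ, 2 * C * (2 ^ (j : ℝ) * μ (E j) ^ (1 / p)) := by
        refine ENNReal.tsum_le_tsum fun j => ?_
        refine (mul_le_mul_right (hE _ (hEfin j)) _).trans (le_of_eq ?_)
        ring
    _ ≤ _ := by
        rw [ENNReal.tsum_mul_left, mul_assoc (2 * C)]
        exact mul_le_mul_right hsum _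

/-! ### Balls, cubes and the two hypotheses on the measures -/

theorem measure_ball_le_of_growthSup_le {n : ℕ} {d : ℝ}
    {μ : Measure (EuclideanSpace ℝ (Fin n))} {A : ℝ≥0∞} (h : growthSup d μ ≤ A)
    (x : EuclideanSpace ℝ (Fin n)) {r : ℝ} (hr : 0 < r) :
    μ (Metric.ball x r) ≤ A * ENNReal.ofReal (r ^ d) := by
  have h1 : μ (Metric.ball x r) / ENNReal.ofReal (r ^ d) ≤ A := by
    simp only [growthSup, iSup_le_iff] at h
    exact h x r hr
  rwa [ENNReal.div_le_iff (by simpa using Real.rpow_pos_of_pos hr d) ENNReal.ofReal_ne_top] at h1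

theorem measure_cube_le_of_cubeRatioSup_le {n : ℕ} {s : ℝ} (hs : 0 ≤ s)
    {μ ν : Measure (EuclideanSpace ℝ (Fin n))} {B : ℝ≥0∞} (h : cubeRatioSup s μ ν ≤ B)
    {a : EuclideanSpace ℝ (Fin n)} {l : ℝ} (hl : 0 < l) (h0 : 0 < μ (cube a l))
    (htop : μ (cube a l) ≠ ∞) : ν (cube a l) ≤ B * μ (cube a l) ^ s := by
  have h1 : ν (cube a l) / μ (cube a l) ^ s ≤ B := by
    simp only [cubeRatioSup, iSup_le_iff] at h
    exact h a l hl h0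
  rwa [ENNReal.div_le_iff (ENNReal.rpow_pos h0 htop).ne' (ENNReal.rpow_ne_top_of_nonneg hs htop)]
    at h1

theorem closedBall_subset_cube {n : ℕ} (x : EuclideanSpace ℝ (Fin n)) {r l : ℝ}
    (h : 2 * r < l) :
    Metric.closedBall x r ⊆ cube (WithLp.toLp 2 fun i => x i - r) l := by
  intro y hy i
  have h1 : |y i - x i| ≤ r := by
    rw [Metric.mem_closedBall, dist_eq_norm] at hy
    exact (PiLp.norm_apply_le (y - x) i).trans hy
  have h2 := abs_le.1 h1
  simp only
  constructor <;> linarith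

theorem cube_subset_ball {n : ℕ} {a x : EuclideanSpace ℝ (Fin n)} {l : ℝ} (hl : 0 < l)
    (hx : x ∈ cube a l) : cube a l ⊆ Metric.ball x ((n + 1) * l) := by
  intro y hy
  rw [Metric.mem_ball, EuclideanSpace.dist_eq, Real.sqrt_lt' (by positivity)]
  have h1 : ∀ i, dist (y i) (x i) ^ 2 ≤ l ^ 2 := fun i => by
    rw [Real.dist_eq, sq_abs]
    refine sq_le_sq' ?_ ?_ <;> linarith [(hx i).1, (hx i).2, (hy i).1, (hy i).2]
  calc ∑ i, dist (y i) (x i) ^ 2 ≤ ∑ _i : Fin n, l ^ 2 := Finset.sum_le_sum fun i _ => h1 i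
    _ = n * l ^ 2 := by simp
    _ < ((n + 1) * l) ^ 2 := by
      have : 0 < l ^ 2 := by positivity
      nlinarith [(Nat.cast_nonneg n : (0 : ℝ) ≤ n)]

theorem ofReal_mul_two_zpow_rpow {c : ℝ} (hc : 0 < c) (i : ℤ) (d : ℝ) :
    ENNReal.ofReal ((c * (2 : ℝ) ^ i) ^ d) = ENNReal.ofReal (c ^ d) * 2 ^ (d * i) := by
  rw [Real.mul_rpow hc.le (by positivity), ENNReal.ofReal_mul (by positivity),
    ← ENNReal.ofReal_rpow_of_pos (by positivity : (0 : ℝ) < 2 ^ i), ofReal_two_zpow,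
    ← ENNReal.rpow_mul, mul_comm (i : ℝ)]

theorem measure_closedBall_le_of_growthSup_le {n : ℕ} {d : ℝ}
    {μ : Measure (EuclideanSpace ℝ (Fin n))} {A : ℝ≥0∞} (h : growthSup d μ ≤ A)
    (x : EuclideanSpace ℝ (Fin n)) (i : ℤ) :
    μ (Metric.closedBall x ((2 : ℝ) ^ i)) ≤ A * ENNReal.ofReal (2 ^ d) * 2 ^ (d * i) := by
  have hi : (0 : ℝ) < 2 ^ i := by positivity
  refine (measure_mono (Metric.closedBall_subset_ball
    (by linarith : (2 : ℝ) ^ i < 2 * 2 ^ i))).trans ?_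
  refine (measure_ball_le_of_growthSup_le h x (by positivity)).trans (le_of_eq ?_)
  rw [ofReal_mul_two_zpow_rpow two_pos, mul_assoc]

/-- A cube around the tripled ball has positive μ-measure, since it contains the small ball, and
μ-measure ≲ r^d by growth. As s ≥ 0, that upper bound can be inserted into μ(Q)^s. -/
theorem measure_closedBall_le_of_cubeRatioSup_le {n : ℕ} {d s : ℝ} (hs : 0 ≤ s)
    {μ ν : Measure (EuclideanSpace ℝ (Fin n))} {A B : ℝ≥0} (hμ : growthSup d μ ≤ A)
    (hν : cubeRatioSup s μ ν ≤ B) (x : EuclideanSpace ℝ (Fin n)) (i : ℤ)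
    (hpos : 0 < μ (Metric.closedBall x ((2 : ℝ) ^ i))) :
    ν (Metric.closedBall x (3 * (2 : ℝ) ^ i)) ≤
      B * (A * ENNReal.ofReal (((n + 1) * 8) ^ d)) ^ s * 2 ^ (d * s * i) := by
  have hi : (0 : ℝ) < 2 ^ i := by positivity
  set a : EuclideanSpace ℝ (Fin n) := WithLp.toLp 2 fun j => x j - 3 * (2 : ℝ) ^ i
  -- Any side above 6 · 2^i would do; strictness is needed because the cube is half-open.
  set l : ℝ := 8 * (2 : ℝ) ^ i with hl
  have hl0 : 0 < l := by positivity
  have hsub : Metric.closedBall x (3 * (2 : ℝ) ^ i) ⊆ cube a l :=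
    closedBall_subset_cube x (by linarith)
  have hx : x ∈ cube a l := hsub (Metric.mem_closedBall_self (by positivity))
  have hle : μ (cube a l) ≤ A * ENNReal.ofReal (((n + 1) * 8) ^ d) * 2 ^ (d * i) := by
    refine (measure_mono (cube_subset_ball hl0 hx)).trans ?_
    refine (measure_ball_le_of_growthSup_le hμ x (by positivity)).trans (le_of_eq ?_)
    rw [hl, ← mul_assoc, ofReal_mul_two_zpow_rpow (by positivity), mul_assoc]
  have htop : μ (cube a l) ≠ ∞ :=
    ne_top_of_le_ne_top (ENNReal.mul_ne_top (by finiteness) (two_rpow_ne_top _)) hle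
  have hpos' : 0 < μ (cube a l) := hpos.trans_le (measure_mono
    ((Metric.closedBall_subset_closedBall (by linarith)).trans hsub))
  refine (measure_mono hsub).trans
    ((measure_cube_le_of_cubeRatioSup_le hs hν hl0 hpos' htop).trans ?_)
  calc _ ≤ (B : ℝ≥0∞) * (A * ENNReal.ofReal (((n + 1) * 8) ^ d) * 2 ^ (d * i)) ^ s := by
        gcongr
    _ = _ := by
        rw [ENNReal.mul_rpow_of_nonneg _ _ hs, ← ENNReal.rpow_mul, ← mul_assoc]
        ring_nf

/-! ### The trace inequality -/

theorem theorem1p4 (n : ℕ) (d α p : ℝ) (hd : 0 < d) (hdn : d ≤ n)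
    (hα : 0 < α) (hαd : α < d) (hp : 1 < p) (hpd : p < d / α) (A B : ℝ≥0) :
    ∃ C : ℝ≥0, 0 < C ∧
      ∀ (μ ν : Measure (EuclideanSpace ℝ (Fin n))), μ.Regular → ν.Regular →
        growthSup d μ ≤ A → cubeRatioSup (1 - α * p / d) μ ν ≤ B →
        ∀ (𝕜 : Type*) [RCLike 𝕜] (f : EuclideanSpace ℝ (Fin n) → 𝕜), MemLorentzOne p μ f →
          (∀ᵐ x ∂ν, Integrable (rieszIntegrand d α f x) μ) ∧
          AEStronglyMeasurable (rieszPotential d α μ f) ν ∧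
          ∫⁻ x, ‖rieszPotential d α μ f x‖ₑ ^ p ∂ν ≤ C * lorentzNormOne p μ f ^ p := by
  have hp0 : 0 < p := by linarith
  have hp1 : 0 < 1 - 1 / p := by
    rw [sub_pos, div_lt_one hp0]; exact hp
  have hs : 0 ≤ 1 - α * p / d := by
    rw [sub_nonneg, div_le_one hd, mul_comm]
    exact ((lt_div_iff₀ hα).1 hpd).le
  set s : ℝ := 1 - α * p / d with hsdef
  have hds : d * s = d - α * p := by rw [hsdef]; field_simp
  set K : ℝ≥0∞ := B * (A * ENNReal.ofReal (((n + 1) * 8) ^ d)) ^ s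
  have hKtop : K ≠ ∞ := ENNReal.mul_ne_top (by simp)
    (ENNReal.rpow_ne_top_of_nonneg hs (by finiteness))
  set C₁ : ℝ≥0∞ := 2 * 2 ^ (d - α) * (dyadicGeom α ^ p * 2 ^ (α * p) * K) ^ (1 / p) *
        (dyadicGeom (1 - 1 / p) * (A * ENNReal.ofReal (2 ^ d)) ^ (1 - 1 / p))
  have hC₁top : C₁ ≠ ∞ := by
    refine ENNReal.mul_ne_top (ENNReal.mul_ne_top (ENNReal.mul_ne_top (by simp)
      (two_rpow_ne_top _)) (ENNReal.rpow_ne_top_of_nonneg (by positivity) ?_))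
      (ENNReal.mul_ne_top (dyadicGeom_ne_top hp1) (ENNReal.rpow_ne_top_of_nonneg hp1.le
        (by finiteness)))
    exact ENNReal.mul_ne_top (ENNReal.mul_ne_top (ENNReal.rpow_ne_top_of_nonneg hp0.le
      (dyadicGeom_ne_top hα)) (two_rpow_ne_top _)) hKtop
  set C₂ : ℝ≥0∞ := (2 * C₁ * dyadicGeom 1) ^ p
  have hC₂top : C₂ ≠ ∞ := ENNReal.rpow_ne_top_of_nonneg hp0.le
    (ENNReal.mul_ne_top (ENNReal.mul_ne_top (by simp) hC₁top) (dyadicGeom_ne_top one_pos))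
  -- Adding 1 keeps the constant positive even when `C₂` vanishes, for instance if A or B is 0.
  refine ⟨C₂.toNNReal + 1, by positivity, ?_⟩
  intro μ ν hμreg _ hμ hν 𝕜 _ f ⟨hf, hfin⟩
  have hrestr : ∀ E : Set (EuclideanSpace ℝ (Fin n)), μ E < ∞ →
      (∫⁻ x, (∫⁻ y in E, ENNReal.ofReal (1 / dist x y ^ (d - α)) ∂μ) ^ p ∂ν) ^ (1 / p) ≤
        C₁ * μ E ^ (1 / p) := by
    intro E hE
    have : IsFiniteMeasure (μ.restrict E) := ⟨by simpa using hE⟩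
    have := lintegral_kernel_rpow_le (μ.restrict E) ν hp hα hαd (K := K)
      (A := A * ENNReal.ofReal (2 ^ d))
      (fun x i hx => by
        rw [← hds]
        exact measure_closedBall_le_of_cubeRatioSup_le hs hμ hν x i
          (hx.trans_le (Measure.restrict_apply_le _ _)))
      (fun x i => (Measure.restrict_apply_le _ _).trans
        (measure_closedBall_le_of_growthSup_le hμ x i))
    rwa [Measure.restrict_apply_univ] at this
  -- The potential of |f|: its ν-a.e. finiteness is absolute convergence, and it dominates the
  -- potential of f.
  set V : EuclideanSpace ℝ (Fin n) → ℝ≥0∞ := fun x =>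
    ∫⁻ y, ENNReal.ofReal (1 / dist x y ^ (d - α)) * ‖f y‖ₑ ∂μ with hV
  have hVint : ∫⁻ x, V x ^ p ∂ν ≤ C₂ * lorentzNormOne p μ f ^ p := by
    have := lintegral_kernel_mul_enorm_rpow_le μ ν hp hrestr hf hfin
    rwa [one_div p, ENNReal.rpow_inv_le_iff hp0, ENNReal.mul_rpow_of_nonneg _ _ hp0.le] at this
  have henorm : ∀ x y, ‖rieszIntegrand d α f x y‖ₑ =
      ENNReal.ofReal (1 / dist x y ^ (d - α)) * ‖f y‖ₑ := by
    intro x y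
    rw [rieszIntegrand, enorm_smul, dist_eq_norm, Real.enorm_of_nonneg (by positivity)]
  -- Joint measurability in (x, y) requires a strongly measurable representative; the exceptional
  -- set is μ-null and independent of x, so every integral in y is unchanged.
  set g := hf.mk f
  have hfg : f =ᵐ[μ] g := hf.ae_eq_mk
  have hker : Measurable fun q : EuclideanSpace ℝ (Fin n) × EuclideanSpace ℝ (Fin n) =>
      1 / ‖q.1 - q.2‖ ^ (d - α) := by fun_prop
  have hVmeas : Measurable V := by
    have h1 : V = fun x => ∫⁻ y, ENNReal.ofReal (1 / dist x y ^ (d - α)) * ‖g y‖ₑ ∂μ := by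
      funext x
      refine lintegral_congr_ae ?_
      filter_upwards [hfg] with y hy
      rw [hy]
    rw [h1]
    have h2 : Measurable fun q : EuclideanSpace ℝ (Fin n) × EuclideanSpace ℝ (Fin n) =>
        ENNReal.ofReal (1 / dist q.1 q.2 ^ (d - α)) * ‖g q.2‖ₑ := by
      exact Measurable.mul (by fun_prop) (hf.stronglyMeasurable_mk.enorm.comp measurable_snd)
    exact h2.lintegral_prod_right'
  refine ⟨?_, ?_, ?_⟩
  · have hlt : ∫⁻ x, V x ^ p ∂ν ≠ ∞ := ne_top_of_le_ne_top
      (ENNReal.mul_ne_top hC₂top (ENNReal.rpow_ne_top_of_nonneg hp0.le hfin.ne)) hVint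
    filter_upwards [ae_lt_top (hVmeas.pow_const p) hlt] with x hx
    refine ⟨?_, ?_⟩
    · have : Measurable fun y => 1 / ‖x - y‖ ^ (d - α) := by fun_prop
      exact this.aestronglyMeasurable.smul hf
    · rw [hasFiniteIntegral_iff_enorm]
      simp_rw [henorm]
      exact (ENNReal.rpow_lt_top_iff_of_pos hp0).1 hx
  · have h1 : rieszPotential d α μ f = fun x => ∫ y, (1 / ‖x - y‖ ^ (d - α)) • g y ∂μ := by
      funext x
      refine integral_congr_ae ?_
      filter_upwards [hfg] with y hy
      rw [rieszIntegrand, hy]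
    rw [h1]
    have h2 : StronglyMeasurable fun q : EuclideanSpace ℝ (Fin n) × EuclideanSpace ℝ (Fin n) =>
        (1 / ‖q.1 - q.2‖ ^ (d - α)) • g q.2 :=
      hker.stronglyMeasurable.smul (hf.stronglyMeasurable_mk.comp_measurable measurable_snd)
    exact h2.integral_prod_right'.aestronglyMeasurable
  · calc _ ≤ ∫⁻ x, V x ^ p ∂ν := by
          gcongr with x
          refine (enorm_integral_le_lintegral_enorm _).trans (le_of_eq ?_)
          simp_rw [henorm, hV]
      _ ≤ C₂ * lorentzNormOne p μ f ^ p := hVint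
      _ ≤ _ := by
          gcongr
          rw [ENNReal.coe_add, ENNReal.coe_toNNReal hC₂top]
          exact le_self_add
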